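/- \textbf{Setting.} Let $A$ be an affine space over a real vector space $L$ (of any, in particular infinite, dimension), with a symplectic potential $\theta:A\times L\to\mathbb{R}$, linear in the second argument, and a bilinear form $[\cdot,\cdot]:L\times L\to\mathbb{R}$ such that $\theta(\eta+\xi,\tau)=\theta(\eta,\tau)+[\xi,\tau]$, and such that the symplectic form $\omega(\xi,\tau)=\frac12[\xi,\tau]-\frac12[\tau,\xi]$ is non-degenerate. Put $M=\{\tau\in L:[\xi,\tau]=0\ \forall\xi\in L\}$ and $N=\{\tau\in L:[\tau,\xi]=0\ \forall\xi\in L\}$. Assume that $M+N=L$ and that $\theta$ is adapted to the polarization $M$, i.e. $\theta(\eta,\tau)=0$ for all $\eta\in A$, $\tau\in M$. Let $q:L\to Q=L/M$ and $c:A\to C=A/M$ be the quotient maps; $[\cdot,\cdot]$ and $\theta$ are viewed also as maps $L\times Q\to\mathbb{R}$ and $A\times Q\to\mathbb{R}$. Let $\Omega:Q\times Q\to\mathbb{C}$ be an admissible form: $\Omega$ is symmetric and real bilinear, $\Re\,\Omega$ is positive definite and makes $Q$ a separable real Hilbert space, $\Im\,\Omega$ is continuous on this Hilbert space, and the continuous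 linear functionals on $Q$ are exactly the maps $\phi\mapsto[\xi,\phi]$ with $\xi\in L$. Let $\hat Q$ be the algebraic dual of the topological dual of $Q$, with the $\sigma$-algebra generated by the cylinder sets, and let $\nu_Q$ be the Gaussian probability measure on $\hat Q$ that is the projective limit of the normalized Gaussian measures proportional to $e^{-\Re\,\Omega(\phi,\phi)}\,d\phi$ on the finite-dimensional quotients of $Q$ by closed subspaces (with the quotient inner product). For $\eta\in A$ the affine coherent state $\hat K_\eta$ has the Schr\"odinger wave function $$\hat K^{\mathrm S}_\eta(\varphi)=\exp\Big(\mathrm{i}\,\theta(\eta,\varphi-c(\eta))-\tfrac12\Omega(\varphi-c(\eta),\varphi-c(\eta))\Big),\qquad \varphi\in C.$$ Given a base point $\eta'\in A$, the Schr\"odinger Hilbert space $\mathcal{H}^{\tilde S}$ is presented as $L^2(\hat Q,\nu_Q)$ by means of $\eta'$-reduced wave functions, and $\hat K_\eta$ is presented by the canonical extension to $\hat Q$ of $$\beta_{\eta,\eta'}(\phi)=\frac{\hat K^{\mathrm S}_\eta(\phi+c(\eta'))}{\hat K^{\mathrm S}_{\eta'}(\phi+c(\eta'))}=\exp\Big(\mathrm{i}\,\theta(\eta,\eta'-\eta)-\tfrac12\Omega(q(\eta'-\eta),q(\eta'-\eta))-\mathrm{i}[\eta'-\eta,\phi]-\Omega(q(\eta'-\eta),\phi)\Big),\qquad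 \phi\in Q.$$ \textbf{Proposition.} For every base point $\eta'\in A$, the functions $\beta_{\eta,\eta'}$, $\eta\in A$, are square-integrable on $(\hat Q,\nu_Q)$, and their complex linear span $\mathcal{H}^{\tilde S,c}$ is dense in $\mathcal{H}^{\tilde S}=L^2(\hat Q,\nu_Q)$. -/

import Mathlib

open MeasureTheory ProbabilityTheory

noncomputable section

namespace SchrodingerRep

/-! ## The algebraic extension of a Hilbert space and its Gaussian measure -/

section GaussianExtension

variable {E : Type*} [NormedAddCommGroup E] [InnerProductSpace ℝ E]

variable (E) in
/-- The extension of a real Hilbert space `E`: the algebraic dual of its topological dual. -/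
abbrev AlgExt : Type _ := StrongDual ℝ E →ₗ[ℝ] ℝ

/-- The `σ`-algebra generated by the cylinder sets, i.e. the smallest one for which all the linear
coordinates `x ↦ x l` are measurable. -/
instance : MeasurableSpace (AlgExt E) :=
  MeasurableSpace.comap (fun (x : AlgExt E) (l : StrongDual ℝ E) => x l) MeasurableSpace.pi

/-- The canonical inclusion of `E` into its extension. -/
def AlgExt.incl (v : E) : AlgExt E where
  toFun l := l v
  map_add' _ _ := rfl
  map_smul' _ _ := rfl

/-- `ν` is the projective limit of the centred Gaussian measures `exp (-‖v‖ ^ 2) dv` (normalized to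
be probability measures) on the finite-dimensional quotients of `E`. Such a quotient is identified
isometrically with `ℝⁿ` by an orthonormal basis `e` of the orthogonal complement of the subspace
divided out, and the projection of the extension onto it is `x ↦ (x ⟪e i, ·⟫)ᵢ`. Recall that
`gaussianReal 0 (1 / 2)` has the density `exp (-t ^ 2) / √π`. -/
def IsGaussianLimit (ν : Measure (AlgExt E)) : Prop :=
  ∀ (n : ℕ) (e : Fin n → E), Orthonormal ℝ e →
    ν.map (fun (x : AlgExt E) (i : Fin n) => x (innerSL ℝ (e i))) =
      Measure.pi (fun _ : Fin n => gaussianReal 0 (1 / 2))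

lemma measurable_algExt_apply (l : StrongDual ℝ E) : Measurable (fun x : AlgExt E => x l) :=
  (measurable_pi_apply l).comp (comap_measurable _)

lemma isGaussianLimit_of_charFun {ν : Measure (AlgExt E)} [IsProbabilityMeasure ν]
    (h : ∀ v : E, ∫ x, Complex.exp (((x (innerSL ℝ v) : ℝ) : ℂ) * Complex.I) ∂ν =
      Complex.exp (-((‖v‖ ^ 2 / 4 : ℝ) : ℂ))) : IsGaussianLimit ν := by
  classical
  intro n e he
  have hm : Measurable (fun (x : AlgExt E) (i : Fin n) => x (innerSL ℝ (e i))) :=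
    measurable_pi_lambda _ fun i => measurable_algExt_apply _
  have : IsProbabilityMeasure
      (ν.map (fun (x : AlgExt E) (i : Fin n) => x (innerSL ℝ (e i)))) :=
    Measure.isProbabilityMeasure_map hm.aemeasurable
  refine Measure.ext_of_charFunDual ?_
  ext l
  have hl : ∀ t : Fin n → ℝ, l t = ∑ i, l (Pi.single i 1) * t i := by
    intro t
    conv_lhs => rw [← Finset.univ_sum_single t]
    rw [map_sum]
    refine Finset.sum_congr rfl fun i _ => ?_
    have : (Pi.single i (t i) : Fin n → ℝ) = t i • Pi.single i 1 := by
      rw [← Pi.single_smul]; simp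
    rw [this, map_smul, smul_eq_mul, mul_comm]
  rw [charFunDual_apply, integral_map hm.aemeasurable (by fun_prop), charFunDual_pi]
  have key : ∀ x : AlgExt E, l (fun i => x (innerSL ℝ (e i))) =
      x (innerSL ℝ (∑ i, l (Pi.single i 1) • e i)) := by
    intro x
    rw [hl]
    simp [map_sum]
  simp_rw [key]
  rw [h]
  have hn : ‖∑ i, l (Pi.single i 1) • e i‖ ^ 2 = ∑ i, l (Pi.single i 1) ^ 2 := by
    rw [← real_inner_self_eq_norm_sq, he.inner_sum]
    simp [sq]
  rw [hn]
  have : ∀ i : Fin n, charFunDual (gaussianReal 0 (1 / 2))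
      (l.comp (ContinuousLinearMap.single ℝ (fun _ : Fin n => ℝ) i)) =
      Complex.exp (-((l (Pi.single i 1) ^ 2 / 4 : ℝ) : ℂ)) := by
    intro i
    have h1 := charFun_gaussianReal (μ := 0) (v := 1 / 2) (l (Pi.single i 1))
    rw [charFun_apply_real] at h1
    rw [charFunDual_apply]
    have : ∀ t : ℝ, (l.comp (ContinuousLinearMap.single ℝ (fun _ : Fin n => ℝ) i)) t =
        l (Pi.single i 1) * t := by
      intro t
      rw [ContinuousLinearMap.comp_apply, hl, Finset.sum_eq_single i] <;> simp +contextual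
    simp_rw [this]
    push_cast at h1 ⊢
    rw [h1]
    congr 1
    ring
  simp_rw [this]
  rw [← Complex.exp_sum]
  congr 1
  push_cast
  rw [Finset.sum_div, ← Finset.sum_neg_distrib]

lemma IsGaussianLimit.isProbabilityMeasure {ν : Measure (AlgExt E)} (h : IsGaussianLimit ν) :
    IsProbabilityMeasure ν := by
  have h0 := h 0 Fin.elim0 ⟨fun i => i.elim0, fun i => i.elim0⟩
  have hm : Measurable (fun (x : AlgExt E) (i : Fin 0) => x (innerSL ℝ (Fin.elim0 i : E))) :=
    measurable_pi_lambda _ fun i => i.elim0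
  constructor
  have := congrArg (fun m => m Set.univ) h0
  simp only [Measure.map_apply hm MeasurableSet.univ, Set.preimage_univ, measure_univ] at this
  exact this

lemma IsGaussianLimit.charFun {ν : Measure (AlgExt E)} (h : IsGaussianLimit ν) (v : E) :
    ∫ x, Complex.exp (((x (innerSL ℝ v) : ℝ) : ℂ) * Complex.I) ∂ν =
      Complex.exp (-((‖v‖ ^ 2 / 4 : ℝ) : ℂ)) := by
  have := h.isProbabilityMeasure
  rcases eq_or_ne v 0 with rfl | hv
  · simp
  have hv' : ‖v‖ ≠ 0 := norm_ne_zero_iff.2 hv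
  have ho : Orthonormal ℝ (fun _ : Fin 1 => ‖v‖⁻¹ • v) := by
    refine ⟨fun _ => ?_, fun i j hij => (hij (Subsingleton.elim i j)).elim⟩
    rw [norm_smul, norm_inv, norm_norm, inv_mul_cancel₀ hv']
  have h1 := h 1 _ ho
  have hm : Measurable (fun (x : AlgExt E) (_ : Fin 1) => x (innerSL ℝ (‖v‖⁻¹ • v))) :=
    measurable_pi_lambda _ fun i => measurable_algExt_apply _
  have h2 : ν.map (fun x : AlgExt E => x (innerSL ℝ (‖v‖⁻¹ • v))) = gaussianReal 0 (1 / 2) := by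
    have h3 := congrArg (fun m : Measure (Fin 1 → ℝ) => m.map (fun t => t 0)) h1
    rw [Measure.map_map (measurable_pi_apply _) hm] at h3
    rw [(measurePreserving_eval (fun _ : Fin 1 => gaussianReal 0 (1 / 2)) 0).map_eq] at h3
    exact h3
  have h4 := charFun_gaussianReal (μ := 0) (v := 1 / 2) ‖v‖
  rw [← h2, charFun_apply_real, integral_map (measurable_algExt_apply _).aemeasurable
    (by fun_prop)] at h4
  have h5 : ∀ x : AlgExt E, ((x (innerSL ℝ v) : ℝ) : ℂ) =
      (‖v‖ : ℂ) * ((x (innerSL ℝ (‖v‖⁻¹ • v)) : ℝ) : ℂ) := by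
    intro x
    rw [map_smul, map_smul, smul_eq_mul]
    push_cast
    rw [← mul_assoc, mul_inv_cancel₀ (by exact_mod_cast hv'), one_mul]
  simp_rw [h5]
  rw [h4]
  congr 1
  push_cast
  ring

lemma IsGaussianLimit.unique [CompleteSpace E] {ν ν' : Measure (AlgExt E)}
    (h : IsGaussianLimit ν) (h' : IsGaussianLimit ν') : ν = ν' := by
  classical
  have := h.isProbabilityMeasure
  have := h'.isProbabilityMeasure
  set c : AlgExt E → StrongDual ℝ E → ℝ := fun x l => x l with hc
  have hcm : Measurable c := comap_measurable _
  have hcP : ∀ (μ : Measure (AlgExt E)) (J : Finset (StrongDual ℝ E)),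
      (μ.map c).map J.restrict = μ.map (fun x (j : J) => x j) := by
    intro μ J
    rw [Measure.map_map (by fun_prop) hcm]
    rfl
  have hlim : ν.map c = ν'.map c := by
    have := Measure.isProbabilityMeasure_map (μ := ν) hcm.aemeasurable
    have := Measure.isProbabilityMeasure_map (μ := ν') hcm.aemeasurable
    refine IsProjectiveLimit.unique (P := fun J => (ν'.map c).map J.restrict) (fun J => ?_)
      (fun J => rfl)
    have hJm : Measurable (fun (x : AlgExt E) (j : J) => x (j : StrongDual ℝ E)) :=
      measurable_pi_lambda _ fun i => measurable_algExt_apply _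
    rw [hcP ν]
    refine Eq.trans ?_ (hcP ν' J).symm
    have := Measure.isProbabilityMeasure_map (μ := ν) hJm.aemeasurable
    have := Measure.isProbabilityMeasure_map (μ := ν') hJm.aemeasurable
    refine Measure.ext_of_charFunDual ?_
    ext L
    rw [charFunDual_apply, charFunDual_apply, integral_map hJm.aemeasurable (by fun_prop),
      integral_map hJm.aemeasurable (by fun_prop)]
    have key : ∀ x : AlgExt E, L (fun j : J => x (j : StrongDual ℝ E)) =
        x (innerSL ℝ ((InnerProductSpace.toDual ℝ E).symm
          (∑ j : J, L (Pi.single j 1) • (j : StrongDual ℝ E)))) := by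
      intro x
      have : innerSL ℝ ((InnerProductSpace.toDual ℝ E).symm
          (∑ j : J, L (Pi.single j 1) • (j : StrongDual ℝ E))) =
          ∑ j : J, L (Pi.single j 1) • (j : StrongDual ℝ E) :=
        (InnerProductSpace.toDual ℝ E).apply_symm_apply _
      rw [this, map_sum]
      conv_lhs => rw [← Finset.univ_sum_single (fun j : J => x (j : StrongDual ℝ E))]
      rw [map_sum]
      refine Finset.sum_congr rfl fun i _ => ?_
      have : (Pi.single i (x i) : J → ℝ) = x i • Pi.single i 1 := by
        rw [← Pi.single_smul]; simp
      rw [this, map_smul, map_smul, smul_eq_mul, smul_eq_mul, mul_comm]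
    simp_rw [key]
    rw [h.charFun, h'.charFun]
  ext s hs
  obtain ⟨t, ht, rfl⟩ := hs
  have := congrArg (fun m => m t) hlim
  simpa only [Measure.map_apply hcm ht] using this

lemma integral_exp_linearCombination {ι : Type*} (a : ι →₀ ℝ) :
    ∫ ω, Complex.exp (((a.sum fun i r => r * ω i : ℝ) : ℂ) * Complex.I)
      ∂(Measure.infinitePi fun _ : ι => gaussianReal 0 1) =
      Complex.exp (-((a.sum fun _ r => r ^ 2 / 2 : ℝ) : ℂ)) := by
  classical
  set P := Measure.infinitePi fun _ : ι => gaussianReal 0 1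
  have hind : iIndepFun (fun (i : a.support) (ω : ι → ℝ) => a i * ω i) P :=
    (iIndepFun_infinitePi (P := fun _ : ι => gaussianReal 0 1)
      (X := fun i (t : ℝ) => a i * t) (by fun_prop)).precomp Subtype.val_injective
  have hm : ∀ (r : ℝ) (i : ι), Measurable fun ω : ι → ℝ => r * ω i := fun r i => by
    fun_prop
  have h1 := hind.charFun_map_fun_sum_eq_prod (fun i => (hm _ _).aemeasurable)
  have h2 := congrFun h1 1
  rw [charFun_apply_real, integral_map
    (Finset.measurable_sum _ fun i _ => hm _ _).aemeasurable (by fun_prop)] at h2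
  rw [Finset.prod_apply] at h2
  have h3 : ∀ i : a.support, charFun (P.map fun ω => a i * ω i) 1 =
      Complex.exp (-((a i ^ 2 / 2 : ℝ) : ℂ)) := by
    intro i
    have h4 := charFun_gaussianReal (μ := 0) (v := 1) (a i)
    rw [charFun_apply_real] at h4
    rw [charFun_apply_real, integral_map (hm _ _).aemeasurable (by fun_prop)]
    have h5 : P.map (fun ω => ω (i : ι)) = gaussianReal 0 1 := Measure.infinitePi_map_eval _ _
    rw [← h5, integral_map (measurable_pi_apply _).aemeasurable (by fun_prop)] at h4
    simp only [Complex.ofReal_one, one_mul, Complex.ofReal_mul]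
    rw [h4]
    congr 1
    push_cast
    ring
  simp_rw [h3] at h2
  rw [← Complex.exp_sum] at h2
  have e1 : ∀ ω : ι → ℝ, (a.sum fun i r => r * ω i) = ∑ i : a.support, a i * ω i := by
    intro ω
    rw [Finsupp.sum, ← Finset.sum_coe_sort]
  have e2 : (a.sum fun _ r => r ^ 2 / 2) = ∑ i : a.support, a i ^ 2 / 2 := by
    rw [Finsupp.sum, ← Finset.sum_coe_sort]
  simp_rw [e1, e2]
  simp only [Complex.ofReal_one, one_mul] at h2
  rw [h2, Finset.sum_neg_distrib]
  push_cast
  rfl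

universe u

lemma exists_isonormal (E : Type u) [NormedAddCommGroup E] [InnerProductSpace ℝ E]
    [CompleteSpace E] :
    ∃ (Ω : Type u) (_ : MeasurableSpace Ω) (P : Measure Ω) (_ : IsProbabilityMeasure P)
      (W : E →ₗ[ℝ] Lp ℝ 2 P),
      ∀ v : E, ∫ ω, Complex.exp (((W v ω : ℝ) : ℂ) * Complex.I) ∂P =
        Complex.exp (-((‖v‖ ^ 2 / 2 : ℝ) : ℂ)) := by
  classical
  obtain ⟨ι, b, -⟩ := exists_hilbertBasis ℝ E
  set P : Measure (ι → ℝ) := Measure.infinitePi fun _ : ι => gaussianReal 0 1 with hP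
  have hlaw : ∀ i : ι, P.map (fun ω => ω i) = gaussianReal 0 1 :=
    fun i => Measure.infinitePi_map_eval _ _
  have hmp : ∀ i : ι, MeasurePreserving (fun ω : ι → ℝ => ω i) P (gaussianReal 0 1) :=
    fun i => ⟨by fun_prop, hlaw i⟩
  have hmem : ∀ i : ι, MemLp (fun ω : ι → ℝ => ω i) 2 P := fun i =>
    (IsGaussian.memLp_two_id (μ := gaussianReal 0 1)).comp_measurePreserving (hmp i)
  set X : ι → Lp ℝ 2 P := fun i => (hmem i).toLp _ with hX
  have hXae : ∀ i, X i =ᵐ[P] fun ω => ω i := fun i => (hmem i).coeFn_toLp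
  have hXo : Orthonormal ℝ X := by
    rw [orthonormal_iff_ite]
    intro i j
    have e : inner ℝ (X i) (X j) = ∫ ω, ω i * ω j ∂P := by
      rw [L2.inner_def]
      refine integral_congr_ae ?_
      filter_upwards [hXae i, hXae j] with ω hi hj
      rw [hi, hj, real_inner_eq_re_inner]
      simp [mul_comm]
    rw [e]
    have hmean : ∀ i, ∫ ω, ω i ∂P = 0 := by
      intro i
      have := integral_map (μ := P) (φ := fun ω => ω i) (f := fun t : ℝ => t)
        (measurable_pi_apply _).aemeasurable (by fun_prop)
      rw [← this, hlaw, integral_id_gaussianReal]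
    split_ifs with hij
    · subst hij
      have h1 := variance_fun_id_gaussianReal (μ := 0) (v := 1)
      rw [variance_eq_integral (by fun_prop), integral_id_gaussianReal, ← hlaw i,
        integral_map (measurable_pi_apply _).aemeasurable (by fun_prop)] at h1
      simpa [sq] using h1
    · have hind := (iIndepFun_infinitePi (P := fun _ : ι => gaussianReal 0 1)
        (X := fun i (t : ℝ) => t) (by fun_prop)).indepFun hij
      have := hind.integral_fun_mul_eq_mul_integral
        (measurable_pi_apply _).aestronglyMeasurable (measurable_pi_apply _).aestronglyMeasurable
      rw [this, hmean, zero_mul]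
  obtain ⟨W, hWb⟩ : ∃ W : E →ₗᵢ[ℝ] Lp ℝ 2 P, ∀ i, W (b i) = X i := by
    refine ⟨hXo.orthogonalFamily.linearIsometry.comp b.repr.toLinearIsometry, fun i => ?_⟩
    have h1 : b.repr (b i) = lp.single 2 i (1 : ℝ) := b.repr_self i
    have h2 := hXo.orthogonalFamily.linearIsometry_apply_single (i := i) (1 : ℝ)
    rw [← h1] at h2
    refine h2.trans ?_
    simp
  refine ⟨ι → ℝ, inferInstance, P, inferInstance, W.toLinearMap, ?_⟩
  -- both sides are continuous in the vector, so it suffices to treat finite combinations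
  have hcont : Continuous fun v : E =>
      ∫ ω, Complex.exp (((W v ω : ℝ) : ℂ) * Complex.I) ∂P := by
    have hint : ∀ v, Integrable (fun ω => Complex.exp (((W v ω : ℝ) : ℂ) * Complex.I)) P := by
      intro v
      refine Integrable.of_bound (C := 1) ?_ (ae_of_all _ fun ω => ?_)
      · exact (by fun_prop : Continuous fun t : ℝ =>
          Complex.exp ((t : ℂ) * Complex.I)).comp_aestronglyMeasurable
            (Lp.aestronglyMeasurable (W v))
      · rw [Complex.norm_exp_ofReal_mul_I]
    refine LipschitzWith.continuous (K := 1) (LipschitzWith.of_dist_le_mul fun v w => ?_)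
    rw [dist_eq_norm, ← integral_sub (hint v) (hint w), NNReal.coe_one, one_mul]
    have hsub : ∀ᵐ ω ∂P, W (v - w) ω = W v ω - W w ω := by
      rw [map_sub]; exact Lp.coeFn_sub _ _
    have hb : ∀ᵐ ω ∂P, ‖Complex.exp (((W v ω : ℝ) : ℂ) * Complex.I) -
        Complex.exp (((W w ω : ℝ) : ℂ) * Complex.I)‖ ≤ ‖W (v - w) ω‖ := by
      filter_upwards [hsub] with ω h
      have : Complex.exp (((W v ω : ℝ) : ℂ) * Complex.I) -
        Complex.exp (((W w ω : ℝ) : ℂ) * Complex.I) =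
        Complex.exp (((W w ω : ℝ) : ℂ) * Complex.I) *
          (Complex.exp (Complex.I * ((W v ω - W w ω : ℝ) : ℂ)) - 1) := by
        rw [mul_sub, ← Complex.exp_add, mul_one]
        congr 2
        push_cast
        ring
      rw [this, norm_mul, Complex.norm_exp_ofReal_mul_I, one_mul, h]
      exact Real.norm_exp_I_mul_ofReal_sub_one_le
    have hL1 : Integrable (fun ω => ‖W (v - w) ω‖) P :=
      ((Lp.memLp (W (v - w))).integrable (by norm_num)).norm
    refine (norm_integral_le_of_norm_le hL1 hb).trans ?_
    have h1 : ∫ ω, ‖W (v - w) ω‖ ∂P = (eLpNorm (W (v - w)) 1 P).toReal := by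
      rw [integral_norm_eq_lintegral_enorm (Lp.aestronglyMeasurable _),
        eLpNorm_one_eq_lintegral_enorm]
    rw [h1, dist_eq_norm, ← W.norm_map (v - w), Lp.norm_def]
    refine ENNReal.toReal_mono (Lp.eLpNorm_ne_top _) ?_
    exact eLpNorm_le_eLpNorm_of_exponent_le (by norm_num) (Lp.aestronglyMeasurable _)
  have hcont' : Continuous fun v : E => Complex.exp (-((‖v‖ ^ 2 / 2 : ℝ) : ℂ)) := by fun_prop
  have hden : Dense (Submodule.span ℝ (Set.range b) : Set E) := by
    have := b.dense_span
    rwa [← Submodule.dense_iff_topologicalClosure_eq_top] at this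
  refine fun v => congrFun (Continuous.ext_on hden hcont hcont' ?_) v
  intro v hv
  obtain ⟨a, rfl⟩ := Finsupp.mem_span_range_iff_exists_finsupp.1 hv
  have hae : ∀ᵐ ω ∂P, W (a.sum fun i r => r • b i) ω = a.sum fun i r => r * ω i := by
    have h1 : W (a.sum fun i r => r • b i) = ∑ i ∈ a.support, a i • X i := by
      simp [Finsupp.sum, map_sum, hWb]
    have h3 : ∀ᵐ ω ∂P, ∀ i ∈ a.support, (a i • X i : Lp ℝ 2 P) ω = a i * ω i := by
      rw [Finset.eventually_all]
      intro i _
      filter_upwards [Lp.coeFn_smul (a i) (X i), hXae i] with ω h4 h5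
      rw [h4, Pi.smul_apply, h5, smul_eq_mul]
    have h2 := Lp.coeFn_finsetSum a.support (fun i => a i • X i)
    rw [h1]
    filter_upwards [h2, h3] with ω h4 h5
    rw [h4, Finsupp.sum, Finset.sum_apply]
    exact Finset.sum_congr rfl h5
  have hn : ‖a.sum fun i r => r • b i‖ ^ 2 / 2 = a.sum fun _ r => r ^ 2 / 2 := by
    rw [← real_inner_self_eq_norm_sq, Finsupp.sum, b.orthonormal.inner_sum, Finsupp.sum,
      Finset.sum_div]
    simp [sq]
  simp only
  rw [hn, ← integral_exp_linearCombination a]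
  refine integral_congr_ae ?_
  filter_upwards [hae] with ω h
  rw [h]

theorem exists_isGaussianLimit [CompleteSpace E] :
    ∃ ν : Measure (AlgExt E), IsGaussianLimit ν := by
  classical
  obtain ⟨Ω, mΩ, P, hP, W, hW⟩ := exists_isonormal E
  let B := Module.Basis.ofVectorSpace ℝ (StrongDual ℝ E)
  let G : StrongDual ℝ E →ₗ[ℝ] Lp ℝ 2 P := (Real.sqrt 2)⁻¹ •
    (W ∘ₗ (InnerProductSpace.toDual ℝ E).symm.toLinearEquiv.toLinearMap)
  let Y : Ω → AlgExt E := fun ω => B.constr ℝ fun i => G (B i) ω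
  have hYe : ∀ l ω, Y ω l = (B.repr l).sum fun i r => r * G (B i) ω := by
    intro l ω
    simp [Y, Module.Basis.constr_apply]
  have hYm : Measurable Y := by
    refine measurable_comap_iff.2 (measurable_pi_lambda _ fun l => ?_)
    change Measurable fun ω => Y ω l
    simp_rw [hYe, Finsupp.sum]
    exact Finset.measurable_sum _ fun i _ =>
      (Lp.stronglyMeasurable (G (B i))).measurable.const_mul _
  have hYae : ∀ l, ∀ᵐ ω ∂P, Y ω l = G l ω := by
    intro l
    have h1 : G l = ∑ i ∈ (B.repr l).support, (B.repr l) i • G (B i) := by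
      conv_lhs => rw [← B.linearCombination_repr l]
      simp [Finsupp.linearCombination_apply, Finsupp.sum, map_sum]
    have h3 : ∀ᵐ ω ∂P, ∀ i ∈ (B.repr l).support,
        ((B.repr l) i • G (B i) : Lp ℝ 2 P) ω = (B.repr l) i * G (B i) ω := by
      rw [Finset.eventually_all]
      intro i _
      filter_upwards [Lp.coeFn_smul ((B.repr l) i) (G (B i))] with ω h4
      rw [h4, Pi.smul_apply, smul_eq_mul]
    have h2 := Lp.coeFn_finsetSum (B.repr l).support (fun i => (B.repr l) i • G (B i))
    rw [h1]
    filter_upwards [h2, h3] with ω h4 h5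
    rw [h4, hYe, Finsupp.sum, Finset.sum_apply]
    exact (Finset.sum_congr rfl h5).symm
  have : IsProbabilityMeasure (P.map Y) := Measure.isProbabilityMeasure_map hYm.aemeasurable
  refine ⟨P.map Y, isGaussianLimit_of_charFun fun v => ?_⟩
  have hm := measurable_algExt_apply (innerSL ℝ v)
  rw [integral_map hYm.aemeasurable
    (by exact (by fun_prop : Measurable fun t : ℝ =>
      Complex.exp ((t : ℂ) * Complex.I)).comp hm |>.aestronglyMeasurable)]
  have hG : G (innerSL ℝ v) = W ((Real.sqrt 2)⁻¹ • v) := by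
    have : (InnerProductSpace.toDual ℝ E).symm (innerSL ℝ v) = v :=
      (InnerProductSpace.toDual ℝ E).symm_apply_apply v
    simp [G, this]
  have h1 : ∫ ω, Complex.exp (((Y ω (innerSL ℝ v) : ℝ) : ℂ) * Complex.I) ∂P =
      ∫ ω, Complex.exp (((W ((Real.sqrt 2)⁻¹ • v) ω : ℝ) : ℂ) * Complex.I) ∂P := by
    refine integral_congr_ae ?_
    filter_upwards [hYae (innerSL ℝ v)] with ω h
    rw [h, hG]
  rw [h1, hW, norm_smul, mul_pow]
  congr 3
  rw [norm_inv, inv_pow, Real.norm_eq_abs, sq_abs, Real.sq_sqrt (by norm_num)]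
  ring

variable (E) in
/-- The Gaussian measure on the extension of `E`; it is the unique measure with the finite-dimensional
projections demanded by `IsGaussianLimit`, see `IsGaussianLimit.unique`. -/
def gaussianExt [CompleteSpace E] : Measure (AlgExt E) :=
  Classical.choose (exists_isGaussianLimit (E := E))

theorem isGaussianLimit_gaussianExt [CompleteSpace E] : IsGaussianLimit (gaussianExt E) :=
  Classical.choose_spec exists_isGaussianLimit

end GaussianExtension

/-! ## Affine field theory -/

/-- The momentum subspace `M = {τ | [ξ, τ] = 0 for all ξ}` of a bilinear form `[·, ·]`. -/
def momentumSpace {L : Type*} [AddCommGroup L] [Module ℝ L] (b : L →ₗ[ℝ] L →ₗ[ℝ] ℝ) :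
    Submodule ℝ L where
  carrier := {τ | ∀ ξ, b ξ τ = 0}
  add_mem' h h' ξ := by rw [map_add, h ξ, h' ξ, add_zero]
  zero_mem' ξ := map_zero _
  smul_mem' r τ h ξ := by rw [map_smul, h ξ, smul_zero]

/-- The subspace `N = {τ | [τ, ξ] = 0 for all ξ}` of a bilinear form `[·, ·]`. -/
def complementSpace {L : Type*} [AddCommGroup L] [Module ℝ L] (b : L →ₗ[ℝ] L →ₗ[ℝ] ℝ) :
    Submodule ℝ L where
  carrier := {τ | ∀ ξ, b τ ξ = 0}
  add_mem' h h' ξ := by rw [map_add, LinearMap.add_apply, h ξ, h' ξ, add_zero]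
  zero_mem' ξ := by rw [map_zero, LinearMap.zero_apply]
  smul_mem' r τ h ξ := by rw [map_smul, LinearMap.smul_apply, h ξ, smul_zero]

/-- The data of an affine field theory: the space of solutions `A`, an affine space over the real
vector space `L`, with a translation-equivariant symplectic potential `θ` that is adapted to the
Schrödinger polarization `M` and whose symplectic form is non-degenerate. -/
structure AffineFieldTheory (L A : Type*) [AddCommGroup L] [Module ℝ L] [AddTorsor L A] where
  /-- the symplectic potential -/
  θ : A → L →ₗ[ℝ] ℝ
  /-- the bilinear form `[·, ·]` -/
  br : L →ₗ[ℝ] L →ₗ[ℝ] ℝ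
  equivariant : ∀ (η : A) (ξ τ : L), θ (ξ +ᵥ η) τ = θ η τ + br ξ τ
  nondegenerate : ∀ ξ : L,
    (∀ τ : L, (1 / 2 : ℝ) * br ξ τ - (1 / 2 : ℝ) * br τ ξ = 0) → ξ = 0
  span_eq_top : momentumSpace br ⊔ complementSpace br = ⊤
  adapted : ∀ (η : A), ∀ τ ∈ momentumSpace br, θ η τ = 0

namespace AffineFieldTheory

variable {L A : Type*} [AddCommGroup L] [Module ℝ L] [AddTorsor L A]
variable (T : AffineFieldTheory L A)

/-- The momentum subspace `M`. -/
abbrev M : Submodule ℝ L := momentumSpace T.br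

/-- The linear space `Q = L / M` over which the space of field configurations is affine. -/
abbrev Q : Type _ := L ⧸ T.M

/-- The quotient map `q : L → Q`. -/
abbrev q : L →ₗ[ℝ] T.Q := T.M.mkQ

/-- The form `[·, ·]` viewed as a map `L × Q → ℝ`. -/
def brQ (ξ : L) : T.Q →ₗ[ℝ] ℝ := T.M.liftQ (T.br ξ) fun _ h => h ξ

/-- Two solutions are equivalent if they differ by an element of `M`. -/
def configSetoid : Setoid A where
  r ζ ζ' := ζ -ᵥ ζ' ∈ T.M
  iseqv :=
    { refl := fun ζ => by rw [vsub_self]; exact zero_mem _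
      symm := fun {ζ ζ'} h => by rw [← neg_vsub_eq_vsub_rev]; exact neg_mem h
      trans := fun {ζ ζ' ζ''} h h' => by
        rw [← vsub_add_vsub_cancel ζ ζ' ζ'']; exact add_mem h h' }

/-- The space `C = A / M` of field configurations. -/
def C : Type _ := Quotient T.configSetoid

/-- The quotient map `c : A → C`. -/
def c (ζ : A) : T.C := Quotient.mk T.configSetoid ζ

/-- A symmetric bilinear form `Ω : Q × Q → ℂ` with positive definite real part. -/
structure PositiveForm where
  /-- the form -/
  Ω : T.Q →ₗ[ℝ] T.Q →ₗ[ℝ] ℂ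
  symm : ∀ φ φ', Ω φ φ' = Ω φ' φ
  pos : ∀ φ, φ ≠ 0 → 0 < (Ω φ φ).re

variable {T}

/-- The space `Q` as an inner product space, with the inner product `Re Ω`. -/
def PositiveForm.Space (_ : T.PositiveForm) : Type _ := T.Q

namespace PositiveForm

variable (V : T.PositiveForm)

/-- The inner product `Re Ω` on `Q`. -/
@[reducible] def core : InnerProductSpace.Core ℝ T.Q where
  inner φ φ' := (V.Ω φ φ').re
  conj_inner_symm φ φ' := by rw [V.symm φ φ']; rfl
  re_inner_nonneg φ := by
    rcases eq_or_ne φ 0 with rfl | h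
    · simp
    · exact (V.pos φ h).le
  add_left φ φ' φ'' := by simp
  smul_left φ φ' r := by simp
  definite φ h := by
    by_contra h0
    exact (V.pos φ h0).ne' h

instance : NormedAddCommGroup V.Space :=
  letI := V.core
  InnerProductSpace.Core.toNormedAddCommGroup (𝕜 := ℝ) (F := T.Q)

instance : InnerProductSpace ℝ V.Space :=
  InnerProductSpace.ofCore V.core.toCore

/-- The identity map from `Q` to `Q` equipped with the inner product `Re Ω`. -/
def toSpace : T.Q ≃ₗ[ℝ] V.Space where
  toFun φ := φ
  invFun φ := φ
  map_add' _ _ := rfl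
  map_smul' _ _ := rfl
  left_inv _ := rfl
  right_inv _ := rfl

lemma inner_toSpace (φ φ' : T.Q) :
    inner ℝ (V.toSpace φ) (V.toSpace φ') = (V.Ω φ φ').re := rfl

end PositiveForm

variable (T)

/-- An admissible form: `Q` is a separable Hilbert space for `Re Ω`, the imaginary part of `Ω` is
continuous for this topology, and the continuous linear functionals on `Q` are exactly the maps
`φ ↦ [ξ, φ]` with `ξ ∈ L`. -/
structure AdmissibleForm extends T.PositiveForm where
  complete : CompleteSpace toPositiveForm.Space
  separable : TopologicalSpace.SeparableSpace toPositiveForm.Space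
  continuous_im : Continuous fun p : toPositiveForm.Space × toPositiveForm.Space =>
    (Ω (toPositiveForm.toSpace.symm p.1) (toPositiveForm.toSpace.symm p.2)).im
  continuous_br : ∀ ξ : L, Continuous fun φ : toPositiveForm.Space =>
    T.brQ ξ (toPositiveForm.toSpace.symm φ)
  exists_br : ∀ f : StrongDual ℝ toPositiveForm.Space, ∃ ξ : L, ∀ φ : T.Q,
    f (toPositiveForm.toSpace φ) = T.brQ ξ φ

namespace AdmissibleForm

variable {T}
variable (V : T.AdmissibleForm)

/-- The real Hilbert space `Q`, with inner product `Re Ω`. -/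
abbrev Space : Type _ := V.toPositiveForm.Space

instance : CompleteSpace V.Space := V.complete

instance : TopologicalSpace.SeparableSpace V.Space := V.separable

/-- The extension `Q̂` of `Q`, the algebraic dual of the topological dual. -/
abbrev Qhat : Type _ := AlgExt V.Space

/-- The inclusion of `Q` into `Q̂`. -/
def incl (φ : T.Q) : V.Qhat := AlgExt.incl (V.toSpace φ)

/-- The Gaussian measure `ν_Q` on `Q̂`. -/
def ν : Measure V.Qhat := gaussianExt V.Space

/-- The continuous functional `φ ↦ [ξ, φ]` on `Q`. -/
def brDual (ξ : L) : StrongDual ℝ V.Space where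
  toLinearMap := T.brQ ξ ∘ₗ V.toSpace.symm.toLinearMap
  cont := V.continuous_br ξ

/-- The continuous functional `φ ↦ Re (Ω (σ, φ))` on `Q`. -/
def reDual (σ : T.Q) : StrongDual ℝ V.Space := innerSL ℝ (V.toSpace σ)

/-- The continuous functional `φ ↦ Im (Ω (σ, φ))` on `Q`. -/
def imDual (σ : T.Q) : StrongDual ℝ V.Space where
  toLinearMap := Complex.imLm ∘ₗ V.Ω σ ∘ₗ V.toSpace.symm.toLinearMap
  cont := V.continuous_im.comp (Continuous.prodMk_right (V.toSpace σ))

/-- The canonical extension to `Q̂` of the functional `φ ↦ Ω (σ, φ)` on `Q`. -/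
def ΩHat (σ : T.Q) (x : V.Qhat) : ℂ :=
  ((x (V.reDual σ) : ℝ) : ℂ) + Complex.I * ((x (V.imDual σ) : ℝ) : ℂ)

/-- The Schrödinger wave function on `C` of the affine coherent state associated to `η ∈ A`, namely
`exp (i θ(η, φ - c(η)) - Ω(φ - c(η), φ - c(η)) / 2)`. -/
def coherentWave (η : A) : T.C → ℂ :=
  Quotient.lift (fun ζ : A => Complex.exp (Complex.I * ((T.θ η (ζ -ᵥ η) : ℝ) : ℂ)
    - 1 / 2 * V.Ω (T.q (ζ -ᵥ η)) (T.q (ζ -ᵥ η)))) fun ζ ζ' h => by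
    have h : ζ -ᵥ ζ' ∈ T.M := h
    have hv : ζ -ᵥ η = (ζ -ᵥ ζ') + (ζ' -ᵥ η) := (vsub_add_vsub_cancel ζ ζ' η).symm
    have hq : T.q (ζ -ᵥ ζ') = 0 := (Submodule.Quotient.mk_eq_zero _).2 h
    simp only [hv, map_add, hq, zero_add, T.adapted η _ h]

/-- The `η'`-reduced wave function of the affine coherent state associated to `η ∈ A`, as a function
on `Q̂`. Its restriction to `Q` is the quotient of the wave functions of the coherent states of `η`
and of `η'`, translated by `c(η')`, see `reducedCoherent_incl`. -/
def reducedCoherent (η η' : A) (x : V.Qhat) : ℂ :=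
  Complex.exp (Complex.I * ((T.θ η (η' -ᵥ η) : ℝ) : ℂ)
    - 1 / 2 * V.Ω (T.q (η' -ᵥ η)) (T.q (η' -ᵥ η))
    - Complex.I * ((x (V.brDual (η' -ᵥ η)) : ℝ) : ℂ)
    - V.ΩHat (T.q (η' -ᵥ η)) x)

lemma ΩHat_incl (σ φ : T.Q) : V.ΩHat σ (V.incl φ) = V.Ω σ φ := by
  have h : V.ΩHat σ (V.incl φ) =
      (((V.Ω σ φ).re : ℝ) : ℂ) + Complex.I * (((V.Ω σ φ).im : ℝ) : ℂ) := rfl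
  rw [h, mul_comm, Complex.re_add_im]

/-- The reduced wave function, evaluated at `φ = q(ζ - η')`, i.e. at `φ + c(η') = c(ζ)`, is
the quotient of the coherent wave functions on `C`. -/
theorem reducedCoherent_incl (η η' ζ : A) :
    V.reducedCoherent η η' (V.incl (T.q (ζ -ᵥ η'))) =
      V.coherentWave η (T.c ζ) / V.coherentWave η' (T.c ζ) := by
  have h1 : V.incl (T.q (ζ -ᵥ η')) (V.brDual (η' -ᵥ η)) = T.br (η' -ᵥ η) (ζ -ᵥ η') := rfl
  have hc : ∀ ξ : A, V.coherentWave ξ (T.c ζ) =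
      Complex.exp (Complex.I * ((T.θ ξ (ζ -ᵥ ξ) : ℝ) : ℂ)
        - 1 / 2 * V.Ω (T.q (ζ -ᵥ ξ)) (T.q (ζ -ᵥ ξ))) := fun _ => rfl
  have hθ : T.θ η' (ζ -ᵥ η') = T.θ η (ζ -ᵥ η') + T.br (η' -ᵥ η) (ζ -ᵥ η') := by
    rw [← T.equivariant, vsub_vadd]
  have hv : ζ -ᵥ η = (η' -ᵥ η) + (ζ -ᵥ η') := by
    rw [add_comm, vsub_add_vsub_cancel]
  rw [hc, hc, ← Complex.exp_sub, reducedCoherent, ΩHat_incl, h1, hθ, hv]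
  congr 1
  simp only [map_add, LinearMap.add_apply, V.symm (T.q (ζ -ᵥ η')) (T.q (η' -ᵥ η)),
    Complex.ofReal_add]
  ring

/-- Reduced wave functions with respect to different base points `η'`, `η''` are related by
`ψ''(φ) = ψ'(φ + q(η'' - η')) β(φ)`, where `β` is the `η''`-reduced wave function of the coherent
state of `η'`. The reduced wave functions of a coherent state are compatible with this. -/
theorem reducedCoherent_base_change (η η' η'' : A) (x : V.Qhat) :
    V.reducedCoherent η η'' x =
      V.reducedCoherent η η' (x + V.incl (T.q (η'' -ᵥ η'))) * V.reducedCoherent η' η'' x := by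
  have hbr : ∀ a b : L, V.brDual (a + b) = V.brDual a + V.brDual b := by
    intro a b
    ext φ
    obtain ⟨φ, rfl⟩ := V.toSpace.surjective φ
    obtain ⟨ξ, rfl⟩ := T.M.mkQ_surjective φ
    change T.br (a + b) ξ = T.br a ξ + T.br b ξ
    rw [map_add, LinearMap.add_apply]
  have hre : ∀ a b : T.Q, V.reDual (a + b) = V.reDual a + V.reDual b := by
    intro a b
    rw [reDual, map_add, map_add]
    rfl
  have him : ∀ a b : T.Q, V.imDual (a + b) = V.imDual a + V.imDual b := by
    intro a b
    ext φ
    obtain ⟨φ, rfl⟩ := V.toSpace.surjective φ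
    change (V.Ω (a + b) φ).im = (V.Ω a φ).im + (V.Ω b φ).im
    rw [map_add, LinearMap.add_apply, Complex.add_im]
  have hΩ : ∀ (a b : T.Q) (y : V.Qhat), V.ΩHat (a + b) y = V.ΩHat a y + V.ΩHat b y := by
    intro a b y
    simp only [ΩHat, hre, him, map_add, Complex.ofReal_add]
    ring
  have hΩ' : ∀ (a : T.Q) (y z : V.Qhat), V.ΩHat a (y + z) = V.ΩHat a y + V.ΩHat a z := by
    intro a y z
    simp only [ΩHat, LinearMap.add_apply, Complex.ofReal_add]
    ring
  have hv : η'' -ᵥ η = (η' -ᵥ η) + (η'' -ᵥ η') := by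
    rw [add_comm, vsub_add_vsub_cancel]
  have hθ : T.θ η' (η'' -ᵥ η') = T.θ η (η'' -ᵥ η') + T.br (η' -ᵥ η) (η'' -ᵥ η') := by
    rw [← T.equivariant, vsub_vadd]
  have h1 : V.incl (T.q (η'' -ᵥ η')) (V.brDual (η' -ᵥ η)) = T.br (η' -ᵥ η) (η'' -ᵥ η') := rfl
  rw [reducedCoherent, reducedCoherent, reducedCoherent, ← Complex.exp_add, hθ, hv]
  congr 1
  simp only [map_add, LinearMap.add_apply, V.symm (T.q (η'' -ᵥ η')) (T.q (η' -ᵥ η)),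
    Complex.ofReal_add, hbr, hΩ, hΩ', ΩHat_incl, h1]
  ring

/-- The subspace of `L²(Q̂, ν_Q)` spanned by the coherent states, in the presentation of states by
`η'`-reduced wave functions. -/
def coherentSubspace (η' : A) : Submodule ℂ (Lp ℂ 2 V.ν) :=
  Submodule.span ℂ {f | ∃ η : A, f =ᵐ[V.ν] V.reducedCoherent η η'}

end AdmissibleForm

end AffineFieldTheory

end SchrodingerRep

end

open MeasureTheory ProbabilityTheory

namespace SchrodingerRep

/-! ### Fourier uniqueness and exponential moments on the algebraic extension. -/

section Characters

variable {E : Type*} [NormedAddCommGroup E] [InnerProductSpace ℝ E]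

/-! The modulus of a reduced coherent wave function is a constant times the real exponential of one
linear coordinate of `Q̂`. That coordinate is a centred Gaussian variable, so all its exponential
moments are finite, and square-integrability follows (`memLp_reducedCoherent`).

For density, the coherent states whose base point differs from `η'` by an element of `M` already
suffice. Along `M` the quadratic form and `Ω` vanish because `q` does, and the constant phase
vanishes because `θ` is adapted; only the character `exp(-i[m, ·])` survives. Since `M + N = L` and
the `N`-component does not contribute to `[·, ·]`, every continuous functional on `Q` is `[m, ·]`
for some `m ∈ M`. So all characters `x ↦ exp(i x(l))` of `Q̂` are coherent states
(`exists_reducedCoherent_eq_character`).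

A function in `L²` orthogonal to all of them is integrable with vanishing Fourier transform, hence
zero (`ae_eq_zero_of_integral_cexp_mul`). This last fact holds for any finite measure on `Q̂`: the
cylinder `σ`-algebra is generated by the linear coordinates, so finite-dimensional Fourier
uniqueness carries over. -/

/-- Finite measures on `AlgExt E` are determined by their characteristic functions. -/
lemma algExt_measure_ext {μ μ' : Measure (AlgExt E)} [IsFiniteMeasure μ] [IsFiniteMeasure μ']
    (h : ∀ l : StrongDual ℝ E, ∫ x, Complex.exp (((x l : ℝ) : ℂ) * Complex.I) ∂μ =
      ∫ x, Complex.exp (((x l : ℝ) : ℂ) * Complex.I) ∂μ') : μ = μ' := by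
  classical
  set c : AlgExt E → StrongDual ℝ E → ℝ := fun x l => x l with hc
  have hcm : Measurable c := comap_measurable _
  have hcP : ∀ (μ : Measure (AlgExt E)) (J : Finset (StrongDual ℝ E)),
      (μ.map c).map J.restrict = μ.map (fun x (j : J) => x j) := by
    intro μ J
    rw [Measure.map_map (by fun_prop) hcm]
    rfl
  -- The second measure supplies the projective family of its own marginals; it remains to see that
  -- the first has the same marginals.
  have hlim : μ.map c = μ'.map c := by
    refine IsProjectiveLimit.unique (P := fun J => (μ'.map c).map J.restrict) (fun J => ?_)
      (fun J => rfl)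
    have hJm : Measurable (fun (x : AlgExt E) (j : J) => x (j : StrongDual ℝ E)) :=
      measurable_pi_lambda _ fun i => measurable_algExt_apply _
    rw [hcP μ]
    refine Eq.trans ?_ (hcP μ' J).symm
    refine Measure.ext_of_charFunDual ?_
    ext L
    rw [charFunDual_apply, charFunDual_apply, integral_map hJm.aemeasurable (by fun_prop),
      integral_map hJm.aemeasurable (by fun_prop)]
    -- Points of `AlgExt E` are linear, so a linear combination of finitely many coordinates is
    -- again one coordinate. Characters of the marginals are thus characters of the whole space.
    have key : ∀ x : AlgExt E, L (fun j : J => x (j : StrongDual ℝ E)) =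
        x (∑ j : J, L (Pi.single j 1) • (j : StrongDual ℝ E)) := by
      intro x
      rw [map_sum]
      conv_lhs => rw [← Finset.univ_sum_single (fun j : J => x (j : StrongDual ℝ E))]
      rw [map_sum]
      refine Finset.sum_congr rfl fun i _ => ?_
      have : (Pi.single i (x i) : J → ℝ) = x i • Pi.single i 1 := by
        rw [← Pi.single_smul]; simp
      rw [this, map_smul, map_smul, smul_eq_mul, smul_eq_mul, mul_comm]
    simp_rw [key]
    exact h _
  -- Every measurable set is a preimage under `c`, so equality of the images gives equality of the
  -- measures.
  ext s hs
  obtain ⟨t, ht, rfl⟩ := hs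
  have := congrArg (fun m => m t) hlim
  simpa only [Measure.map_apply hcm ht] using this

lemma measurable_cexp_algExt (l : StrongDual ℝ E) :
    Measurable fun x : AlgExt E => Complex.exp (((x l : ℝ) : ℂ) * Complex.I) :=
  (by fun_prop : Measurable fun t : ℝ => Complex.exp ((t : ℂ) * Complex.I)).comp
    (measurable_algExt_apply l)

lemma integrable_cexp_mul {ν : Measure (AlgExt E)} {f : AlgExt E → ℂ} (hf : Integrable f ν)
    (l : StrongDual ℝ E) :
    Integrable (fun x => Complex.exp (((x l : ℝ) : ℂ) * Complex.I) * f x) ν :=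
  hf.bdd_mul (c := 1) (measurable_cexp_algExt l).aestronglyMeasurable
    (ae_of_all _ fun x => by rw [Complex.norm_exp_ofReal_mul_I])

/-- The positive and negative parts of `u`, taken as densities against `ν`, give two finite measures
with the same characteristic function, hence equal. Then the two parts agree almost everywhere, and
as at most one is nonzero at each point, both vanish. -/
lemma ae_eq_zero_of_integral_cexp_mul_ofReal {ν : Measure (AlgExt E)} [IsFiniteMeasure ν]
    {u : AlgExt E → ℝ} (hu : Integrable u ν)
    (h : ∀ l : StrongDual ℝ E,
      ∫ x, Complex.exp (((x l : ℝ) : ℂ) * Complex.I) * (u x : ℂ) ∂ν = 0) : u =ᵐ[ν] 0 := by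
  have hfin : ∀ {w : AlgExt E → ℝ}, Integrable w ν →
      IsFiniteMeasure (ν.withDensity fun x => ENNReal.ofReal (w x)) := fun hw =>
    isFiniteMeasure_withDensity_ofReal hw.2
  have := hfin hu
  have := hfin hu.neg
  have hdens : ∀ {w : AlgExt E → ℝ}, Integrable w ν → ∀ l : StrongDual ℝ E,
      ∫ x, Complex.exp (((x l : ℝ) : ℂ) * Complex.I)
        ∂(ν.withDensity fun x => ENNReal.ofReal (w x)) =
      ∫ x, Complex.exp (((x l : ℝ) : ℂ) * Complex.I) * ((max (w x) 0 : ℝ) : ℂ) ∂ν := by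
    intro w hw l
    rw [integral_withDensity_eq_integral_toReal_smul₀ hw.1.aemeasurable.ennreal_ofReal
      (ae_of_all _ fun _ => ENNReal.ofReal_lt_top)]
    refine integral_congr_ae (ae_of_all _ fun x => ?_)
    simp only [ENNReal.toReal_ofReal', Complex.real_smul]
    rw [mul_comm]
  have hpos : ∀ {w : AlgExt E → ℝ}, Integrable w ν →
      Integrable (fun x => ((max (w x) 0 : ℝ) : ℂ)) ν := fun hw => hw.pos_part.ofReal
  have heq : (ν.withDensity fun x => ENNReal.ofReal (u x)) =
      ν.withDensity fun x => ENNReal.ofReal ((-u) x) := by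
    refine algExt_measure_ext fun l => ?_
    rw [hdens hu, hdens hu.neg, ← sub_eq_zero,
      ← integral_sub (integrable_cexp_mul (hpos hu) l)
        (integrable_cexp_mul (hpos hu.neg) l), ← h l]
    refine integral_congr_ae (ae_of_all _ fun x => ?_)
    simp only
    rw [← mul_sub, ← Complex.ofReal_sub]
    congr 2
    exact max_zero_sub_eq_self (u x)
  have hae := (withDensity_eq_iff hu.1.aemeasurable.ennreal_ofReal
    hu.neg.1.aemeasurable.ennreal_ofReal hu.lintegral_lt_top.ne).1 heq
  filter_upwards [hae] with x hx
  simp only [Pi.neg_apply] at hx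
  rcases le_total (u x) 0 with h0 | h0
  · rw [ENNReal.ofReal_of_nonpos h0, eq_comm, ENNReal.ofReal_eq_zero] at hx
    exact le_antisymm h0 (by simpa using hx)
  · rw [ENNReal.ofReal_of_nonpos (neg_nonpos.2 h0), ENNReal.ofReal_eq_zero] at hx
    exact le_antisymm hx h0

/-- An integrable function on `AlgExt E` whose Fourier transform vanishes is zero. -/
lemma ae_eq_zero_of_integral_cexp_mul {ν : Measure (AlgExt E)} [IsFiniteMeasure ν]
    {f : AlgExt E → ℂ} (hf : Integrable f ν)
    (h : ∀ l : StrongDual ℝ E,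
      ∫ x, Complex.exp (((x l : ℝ) : ℂ) * Complex.I) * f x ∂ν = 0) : f =ᵐ[ν] 0 := by
  have hfc : Integrable (fun x => (starRingEnd ℂ) (f x)) ν :=
    (LinearIsometryEquiv.integrable_comp_iff Complex.conjLIE).2 hf
  -- Conjugating the hypothesis at `-l` shows that the conjugate of `f` has vanishing transform too,
  -- so the real and imaginary parts can be treated separately.
  have hc : ∀ l : StrongDual ℝ E,
      ∫ x, Complex.exp (((x l : ℝ) : ℂ) * Complex.I) * (starRingEnd ℂ) (f x) ∂ν = 0 := by
    intro l
    have h1 := congrArg (starRingEnd ℂ) (h (-l))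
    rw [← integral_conj, map_zero] at h1
    rw [← h1]
    refine integral_congr_ae (ae_of_all _ fun x => ?_)
    simp [← Complex.exp_conj]
  have hre : (fun x => (f x).re) =ᵐ[ν] 0 := by
    refine ae_eq_zero_of_integral_cexp_mul_ofReal hf.re fun l => ?_
    have h1 := integral_add (integrable_cexp_mul hf l) (integrable_cexp_mul hfc l)
    rw [h, hc, add_zero] at h1
    have h2 := congrArg (fun z : ℂ => 1 / 2 * z) h1
    simp only [mul_zero, ← integral_const_mul] at h2
    rw [← h2]
    refine integral_congr_ae (ae_of_all _ fun x => ?_)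
    simp only [Complex.re_eq_add_conj]
    ring
  have him : (fun x => (f x).im) =ᵐ[ν] 0 := by
    refine ae_eq_zero_of_integral_cexp_mul_ofReal hf.im fun l => ?_
    have h1 := integral_sub (integrable_cexp_mul hf l) (integrable_cexp_mul hfc l)
    rw [h, hc, sub_zero] at h1
    have h2 := congrArg (fun z : ℂ => 1 / (2 * Complex.I) * z) h1
    simp only [mul_zero, ← integral_const_mul] at h2
    rw [← h2]
    refine integral_congr_ae (ae_of_all _ fun x => ?_)
    simp only [Complex.im_eq_sub_conj]
    ring
  filter_upwards [hre, him] with x h1 h2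
  exact Complex.ext h1 h2

/-- The characteristic function of this coordinate at `t` is the one of `ν` at `t • v`, namely
`exp(-t²‖v‖²/4)`, which gives variance `‖v‖²/2`. The case `v = 0` is the Dirac mass. -/
lemma IsGaussianLimit.map_innerSL {ν : Measure (AlgExt E)} (h : IsGaussianLimit ν) (v : E) :
    ν.map (fun x : AlgExt E => x (innerSL ℝ v)) = gaussianReal 0 (‖v‖₊ ^ 2 / 2) := by
  have := h.isProbabilityMeasure
  have hm := measurable_algExt_apply (innerSL ℝ v)
  have := Measure.isProbabilityMeasure_map (μ := ν) hm.aemeasurable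
  refine Measure.ext_of_charFun ?_
  ext t
  rw [charFun_gaussianReal, charFun_apply_real, integral_map hm.aemeasurable (by fun_prop)]
  have h1 : ∀ x : AlgExt E, (t : ℂ) * ((x (innerSL ℝ v) : ℝ) : ℂ) =
      ((x (innerSL ℝ (t • v)) : ℝ) : ℂ) := by
    intro x
    rw [map_smul, map_smul, smul_eq_mul, Complex.ofReal_mul]
  simp_rw [h1]
  rw [h.charFun, norm_smul, mul_pow, Real.norm_eq_abs, sq_abs]
  congr 1
  push_cast
  ring

lemma IsGaussianLimit.integrable_exp {ν : Measure (AlgExt E)} (h : IsGaussianLimit ν) (v : E)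
    (t : ℝ) : Integrable (fun x : AlgExt E => Real.exp (t * x (innerSL ℝ v))) ν := by
  have h1 := integrable_exp_mul_gaussianReal (μ := 0) (v := ‖v‖₊ ^ 2 / 2) t
  rw [← h.map_innerSL v] at h1
  exact h1.comp_measurable (measurable_algExt_apply _)

end Characters

/-! ### Square-integrability and density of the coherent states. -/

namespace AffineFieldTheory.AdmissibleForm

variable {L A : Type*} [AddCommGroup L] [Module ℝ L] [AddTorsor L A]
variable {T : AffineFieldTheory L A} (V : T.AdmissibleForm)

lemma isGaussianLimit_ν : IsGaussianLimit V.ν := isGaussianLimit_gaussianExt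

instance : IsProbabilityMeasure V.ν := V.isGaussianLimit_ν.isProbabilityMeasure

lemma measurable_reducedCoherent (η η' : A) : Measurable (V.reducedCoherent η η') := by
  have hb := measurable_algExt_apply (V.brDual (η' -ᵥ η))
  have hr := measurable_algExt_apply (V.reDual (T.q (η' -ᵥ η)))
  have hi := measurable_algExt_apply (V.imDual (T.q (η' -ᵥ η)))
  exact Complex.measurable_exp.comp ((measurable_const.sub (hb.complex_ofReal.const_mul _)).sub
    (hr.complex_ofReal.add (hi.complex_ofReal.const_mul _)))

/-- The terms in `θ`, `[·, ·]` and `Im Ω` are pure phases; only `Re Ω` contributes to the modulus.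
-/
lemma norm_reducedCoherent (η η' : A) (x : V.Qhat) :
    ‖V.reducedCoherent η η' x‖ =
      Real.exp (-(1 / 2) * (V.Ω (T.q (η' -ᵥ η)) (T.q (η' -ᵥ η))).re) *
        Real.exp (-x (V.reDual (T.q (η' -ᵥ η)))) := by
  rw [reducedCoherent, Complex.norm_exp, ← Real.exp_add]
  congr 1
  simp [ΩHat]
  ring

lemma memLp_reducedCoherent (η η' : A) : MemLp (V.reducedCoherent η η') 2 V.ν := by
  rw [memLp_two_iff_integrable_sq_norm (V.measurable_reducedCoherent η η').aestronglyMeasurable]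
  -- The exponent `-2` comes from squaring `exp(-x(reDual σ))`.
  refine ((V.isGaussianLimit_ν.integrable_exp (V.toSpace (T.q (η' -ᵥ η))) (-2)).const_mul
    (Real.exp (-(1 / 2) * (V.Ω (T.q (η' -ᵥ η)) (T.q (η' -ᵥ η))).re) ^ 2)).congr
    (ae_of_all _ fun x => ?_)
  simp only
  rw [norm_reducedCoherent, mul_pow, ← Real.exp_nat_mul (-x _)]
  congr 2
  push_cast
  rw [reDual]
  ring

/-- Every continuous functional on `Q` is of the form `[m, ·]` with `m ∈ M`. -/
lemma exists_brDual_eq (l : StrongDual ℝ V.Space) : ∃ m ∈ T.M, V.brDual m = l := by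
  obtain ⟨ξ, hξ⟩ := V.exists_br l
  -- Here `M + N = L` enters: the component `n ∈ N` of the representing vector pairs to zero, so `m`
  -- alone represents `l`.
  obtain ⟨m, hm, n, hn, rfl⟩ := Submodule.mem_sup.1 (T.span_eq_top ▸ Submodule.mem_top (x := ξ))
  refine ⟨m, hm, ?_⟩
  ext φ
  obtain ⟨φ, rfl⟩ := V.toSpace.surjective φ
  rw [hξ]
  obtain ⟨τ, rfl⟩ := T.M.mkQ_surjective φ
  change T.br m τ = T.br (m + n) τ
  rw [map_add, LinearMap.add_apply, hn τ, add_zero]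

/-- The coherent states displaced from the base point along `M` are the characters of `Q̂`. -/
lemma exists_reducedCoherent_eq_character (η' : A) (l : StrongDual ℝ V.Space) :
    ∃ η : A, ∀ x, V.reducedCoherent η η' x = Complex.exp (((x l : ℝ) : ℂ) * Complex.I) := by
  -- The bracket enters the reduced wave function as `-i[η' - η, ·]`, so `m` must represent `-l`;
  -- the displacement `-m` makes `η' - η = m`.
  obtain ⟨m, hm, hl⟩ := V.exists_brDual_eq (-l)
  refine ⟨-m +ᵥ η', fun x => ?_⟩
  have hv : η' -ᵥ (-m +ᵥ η') = m := by rw [vsub_vadd_eq_vsub_sub, vsub_self]; simp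
  have hq : T.q m = 0 := (Submodule.Quotient.mk_eq_zero _).2 hm
  have hre : V.reDual 0 = 0 := by rw [reDual, map_zero, map_zero]
  have him : V.imDual 0 = 0 := by
    ext φ
    change (V.Ω 0 (V.toSpace.symm φ)).im = 0
    rw [map_zero, LinearMap.zero_apply, Complex.zero_im]
  rw [reducedCoherent, hv, hq, hl, T.adapted _ m hm, ΩHat, hre, him]
  congr 1
  simp only [map_zero, map_neg, Complex.ofReal_zero, Complex.ofReal_neg]
  ring

lemma dense_coherentSubspace (η' : A) : Dense (V.coherentSubspace η' : Set (Lp ℂ 2 V.ν)) := by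
  rw [Submodule.dense_iff_topologicalClosure_eq_top, Submodule.topologicalClosure_eq_top_iff,
    Submodule.eq_bot_iff]
  intro f hf
  rw [Lp.eq_zero_iff_ae_eq_zero]
  -- Integrability holds because `L²` embeds in `L¹` for a probability measure.
  refine ae_eq_zero_of_integral_cexp_mul ((Lp.memLp f).integrable (by norm_num)) fun l => ?_
  -- The inner product conjugates its first argument, so the character of `-l` is paired with `f` to
  -- produce that of `l`.
  obtain ⟨η, hη⟩ := V.exists_reducedCoherent_eq_character η' (-l)
  have hg := (V.memLp_reducedCoherent η η').coeFn_toLp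
  have h0 := (Submodule.mem_orthogonal _ _).1 hf _ (Submodule.subset_span ⟨η, hg⟩)
  rw [L2.inner_def] at h0
  rw [← h0]
  refine integral_congr_ae ?_
  filter_upwards [hg] with x hx
  rw [hx, hη, RCLike.inner_apply, ← Complex.exp_conj, mul_comm]
  simp

end AffineFieldTheory.AdmissibleForm

end SchrodingerRep

theorem mainTheorem11 {L A : Type*} [AddCommGroup L] [Module ℝ L] [AddTorsor L A]
    (T : SchrodingerRep.AffineFieldTheory L A) (V : T.AdmissibleForm) (η' : A) :
    (∀ η : A, MeasureTheory.MemLp (V.reducedCoherent η η') 2 V.ν) ∧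
      Dense (V.coherentSubspace η' : Set (MeasureTheory.Lp ℂ 2 V.ν)) :=
  ⟨fun η => V.memLp_reducedCoherent η η', V.dense_coherentSubspace η'⟩
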